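/- **Corollary (Stallings sequence).** Let $\mathbb F$ be a field. A *triassociative algebra* over $\mathbb F$ is a vector space with three bilinear products $\vdash,\dashv,\perp$ satisfying, for all $x,y,z$, \begin{align*} &(x\vdash y)\vdash z=x\vdash(y\vdash z), && (x\dashv y)\dashv z=x\dashv(y\dashv z),\\ &(x\dashv y)\vdash z=x\vdash(y\vdash z), && (x\dashv y)\dashv z=x\dashv(y\vdash z),\\ &(x\vdash y)\dashv z=x\vdash(y\dashv z), && (x\dashv y)\dashv z=x\dashv(y\perp z),\\ &(x\perp y)\vdash z=x\vdash(y\vdash z), && (x\perp y)\dashv z=x\perp(y\dashv z),\\ &(x\vdash y)\perp z=x\vdash(y\perp z), && (x\dashv y)\perp z=x\perp(y\vdash z),\\ &(x\perp y)\perp z=x\perp(y\perp z). \end{align*} Its center $Z(L)$ consists of all $z$ with $z*x=x*z=0$ for all $x\in L$ and $*\in\{\vdash,\dashv,\perp\}$, and $L'=L\vdash L+L\dashv L+L\perp L$ is its derived ideal, where $L*L$ is the span of the products $x*y$. A *defining pair* for $L$ is a pair $(K,M)$, where $K$ is a triassociative algebra with a surjective homomorphism $p:K\to L$ and $M=\ker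 p\subseteq Z(K)\cap K'$. If $\dim K$ is maximal among all defining pairs for $L$, then $K$ is called a *cover* of $L$ and $M(L)=M=\ker p$ the *multiplier* of $L$. Let $Z$ be a central ideal (that is, an ideal contained in $Z(L)$) of a finite-dimensional triassociative algebra $L$ over $\mathbb F$. Then $L$ and $L/Z$ have covers, and for every choice of covers $p:K\to L$ and $q:T\to L/Z$, with $M(L)=\ker p$ and $M(L/Z)=\ker q$, the sequence \[M(L)\xrightarrow{\ \beta\ }M(L/Z)\xrightarrow{\ \gamma\ }Z\longrightarrow L/L'\longrightarrow \frac{L}{Z+L'}\longrightarrow 0\] is exact. Here the last two nonzero maps are the canonical ones, $z\mapsto z+L'$ and $x+L'\mapsto x+(Z+L')$, and $\beta$, $\gamma$ are the natural linear maps determined as follows. There is a homomorphism $f:K\to T$ such that $q\circ f$ is the composite $K\xrightarrow{p}L\to L/Z$, and $\beta$ is the restriction to $M(L)$ of any such $f$. There is a homomorphism $g:T\to L$ whose composite with $L\to L/Z$ is $q$, and $\gamma$ is the restriction to $M(L/Z)$ of any such $g$. -/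

import Mathlib

universe u v

namespace Triassoc

/-- The names of the three products `⊢`, `⊣`, `⊥` of a triassociative algebra. -/
inductive TriOp : Type
  | vdash
  | dashv
  | perp

/-- A triassociative algebra over the field `k`: a vector space with three bilinear products
`x ⊢ y = mul .vdash x y`, `x ⊣ y = mul .dashv x y`, `x ⊥ y = mul .perp x y` subject to the
eleven relations of Loday and Ronco. -/
class TriassociativeAlgebra (k : Type v) (L : Type u) [Field k] [AddCommGroup L] [Module k L] where
  mul : TriOp → L →ₗ[k] L →ₗ[k] L
  /-- `(x ⊢ y) ⊢ z = x ⊢ (y ⊢ z)` -/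
  rel_one : ∀ x y z : L, mul .vdash (mul .vdash x y) z = mul .vdash x (mul .vdash y z)
  /-- `(x ⊣ y) ⊣ z = x ⊣ (y ⊣ z)` -/
  rel_two : ∀ x y z : L, mul .dashv (mul .dashv x y) z = mul .dashv x (mul .dashv y z)
  /-- `(x ⊣ y) ⊢ z = x ⊢ (y ⊢ z)` -/
  rel_three : ∀ x y z : L, mul .vdash (mul .dashv x y) z = mul .vdash x (mul .vdash y z)
  /-- `(x ⊣ y) ⊣ z = x ⊣ (y ⊢ z)` -/
  rel_four : ∀ x y z : L, mul .dashv (mul .dashv x y) z = mul .dashv x (mul .vdash y z)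
  /-- `(x ⊢ y) ⊣ z = x ⊢ (y ⊣ z)` -/
  rel_five : ∀ x y z : L, mul .dashv (mul .vdash x y) z = mul .vdash x (mul .dashv y z)
  /-- `(x ⊥ y) ⊢ z = x ⊢ (y ⊢ z)` -/
  rel_six : ∀ x y z : L, mul .vdash (mul .perp x y) z = mul .vdash x (mul .vdash y z)
  /-- `(x ⊣ y) ⊣ z = x ⊣ (y ⊥ z)` -/
  rel_seven : ∀ x y z : L, mul .dashv (mul .dashv x y) z = mul .dashv x (mul .perp y z)
  /-- `(x ⊢ y) ⊥ z = x ⊢ (y ⊥ z)` -/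
  rel_eight : ∀ x y z : L, mul .perp (mul .vdash x y) z = mul .vdash x (mul .perp y z)
  /-- `(x ⊥ y) ⊣ z = x ⊥ (y ⊣ z)` -/
  rel_nine : ∀ x y z : L, mul .dashv (mul .perp x y) z = mul .perp x (mul .dashv y z)
  /-- `(x ⊣ y) ⊥ z = x ⊥ (y ⊢ z)` -/
  rel_ten : ∀ x y z : L, mul .perp (mul .dashv x y) z = mul .perp x (mul .vdash y z)
  /-- `(x ⊥ y) ⊥ z = x ⊥ (y ⊥ z)` -/
  rel_eleven : ∀ x y z : L, mul .perp (mul .perp x y) z = mul .perp x (mul .perp y z)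

section Basic

variable (k : Type v) (L : Type u) [Field k] [AddCommGroup L] [Module k L]
  [TriassociativeAlgebra k L]

/-- The three products of `L`, with the field explicit. -/
abbrev op {L : Type u} [AddCommGroup L] [Module k L] [TriassociativeAlgebra k L]
    (o : TriOp) : L →ₗ[k] L →ₗ[k] L :=
  TriassociativeAlgebra.mul o

/-- A two-sided ideal: a subspace that is stable under all products from both sides. -/
structure TriIdeal extends Submodule k L where
  op_mem_left : ∀ (o : TriOp) (x y : L), x ∈ toSubmodule → op k o x y ∈ toSubmodule
  op_mem_right : ∀ (o : TriOp) (x y : L), y ∈ toSubmodule → op k o x y ∈ toSubmodule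

/-- The center `Z(L)`: all `z` with `z * x = x * z = 0` for every `x` and each product `*`. -/
def center : Submodule k L where
  carrier := {z | ∀ (o : TriOp) (x : L), op k o z x = 0 ∧ op k o x z = 0}
  add_mem' := by
    intro a b ha hb o x
    simp [(ha o x).1, (ha o x).2, (hb o x).1, (hb o x).2]
  zero_mem' := by
    intro o x
    simp
  smul_mem' := by
    intro c a ha o x
    simp [(ha o x).1, (ha o x).2]

/-- `S ◇ T = S ⊢ T + S ⊣ T + S ⊥ T`, where `S * T` is spanned by the products `s * t`. -/
def lozenge {L : Type u} [AddCommGroup L] [Module k L] [TriassociativeAlgebra k L]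
    (S T : Submodule k L) : Submodule k L :=
  Submodule.map₂ (op k .vdash) S T ⊔ Submodule.map₂ (op k .dashv) S T ⊔
    Submodule.map₂ (op k .perp) S T

/-- The derived ideal `L' = L ◇ L`. -/
def derived : Submodule k L := lozenge k ⊤ ⊤

end Basic

section Quotient

variable {k : Type v} {L : Type u} [Field k] [AddCommGroup L] [Module k L]
  [TriassociativeAlgebra k L]

/-- The products of `L ⧸ I`: `(x + I) * (y + I) = x * y + I`. -/
def quotientOp (I : TriIdeal k L) (o : TriOp) :
    (L ⧸ I.toSubmodule) →ₗ[k] (L ⧸ I.toSubmodule) →ₗ[k] (L ⧸ I.toSubmodule) :=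
  I.toSubmodule.liftQ
    { toFun := fun x => I.toSubmodule.mapQ I.toSubmodule (op k o x)
        (fun y hy => I.op_mem_right o x y hy)
      map_add' := by
        intro x y
        ext z
        simp
      map_smul' := by
        intro c x
        ext z
        simp }
    (by
      intro x hx
      rw [LinearMap.mem_ker]
      ext z
      simpa using I.op_mem_left o x z hx)

theorem quotientOp_mk (I : TriIdeal k L) (o : TriOp) (x y : L) :
    quotientOp I o (I.toSubmodule.mkQ x) (I.toSubmodule.mkQ y) =
      I.toSubmodule.mkQ (op k o x y) := rfl

/-- The quotient triassociative algebra `L ⧸ I`. -/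
instance quotientAlgebra (I : TriIdeal k L) : TriassociativeAlgebra k (L ⧸ I.toSubmodule) where
  mul := quotientOp I
  rel_one := by
    intro x y z
    obtain ⟨x, rfl⟩ := I.toSubmodule.mkQ_surjective x
    obtain ⟨y, rfl⟩ := I.toSubmodule.mkQ_surjective y
    obtain ⟨z, rfl⟩ := I.toSubmodule.mkQ_surjective z
    simp only [quotientOp_mk, op, TriassociativeAlgebra.rel_one]
  rel_two := by
    intro x y z
    obtain ⟨x, rfl⟩ := I.toSubmodule.mkQ_surjective x
    obtain ⟨y, rfl⟩ := I.toSubmodule.mkQ_surjective y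
    obtain ⟨z, rfl⟩ := I.toSubmodule.mkQ_surjective z
    simp only [quotientOp_mk, op, TriassociativeAlgebra.rel_two]
  rel_three := by
    intro x y z
    obtain ⟨x, rfl⟩ := I.toSubmodule.mkQ_surjective x
    obtain ⟨y, rfl⟩ := I.toSubmodule.mkQ_surjective y
    obtain ⟨z, rfl⟩ := I.toSubmodule.mkQ_surjective z
    simp only [quotientOp_mk, op, TriassociativeAlgebra.rel_three]
  rel_four := by
    intro x y z
    obtain ⟨x, rfl⟩ := I.toSubmodule.mkQ_surjective x
    obtain ⟨y, rfl⟩ := I.toSubmodule.mkQ_surjective y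
    obtain ⟨z, rfl⟩ := I.toSubmodule.mkQ_surjective z
    simp only [quotientOp_mk, op, TriassociativeAlgebra.rel_four]
  rel_five := by
    intro x y z
    obtain ⟨x, rfl⟩ := I.toSubmodule.mkQ_surjective x
    obtain ⟨y, rfl⟩ := I.toSubmodule.mkQ_surjective y
    obtain ⟨z, rfl⟩ := I.toSubmodule.mkQ_surjective z
    simp only [quotientOp_mk, op, TriassociativeAlgebra.rel_five]
  rel_six := by
    intro x y z
    obtain ⟨x, rfl⟩ := I.toSubmodule.mkQ_surjective x
    obtain ⟨y, rfl⟩ := I.toSubmodule.mkQ_surjective y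
    obtain ⟨z, rfl⟩ := I.toSubmodule.mkQ_surjective z
    simp only [quotientOp_mk, op, TriassociativeAlgebra.rel_six]
  rel_seven := by
    intro x y z
    obtain ⟨x, rfl⟩ := I.toSubmodule.mkQ_surjective x
    obtain ⟨y, rfl⟩ := I.toSubmodule.mkQ_surjective y
    obtain ⟨z, rfl⟩ := I.toSubmodule.mkQ_surjective z
    simp only [quotientOp_mk, op, TriassociativeAlgebra.rel_seven]
  rel_eight := by
    intro x y z
    obtain ⟨x, rfl⟩ := I.toSubmodule.mkQ_surjective x
    obtain ⟨y, rfl⟩ := I.toSubmodule.mkQ_surjective y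
    obtain ⟨z, rfl⟩ := I.toSubmodule.mkQ_surjective z
    simp only [quotientOp_mk, op, TriassociativeAlgebra.rel_eight]
  rel_nine := by
    intro x y z
    obtain ⟨x, rfl⟩ := I.toSubmodule.mkQ_surjective x
    obtain ⟨y, rfl⟩ := I.toSubmodule.mkQ_surjective y
    obtain ⟨z, rfl⟩ := I.toSubmodule.mkQ_surjective z
    simp only [quotientOp_mk, op, TriassociativeAlgebra.rel_nine]
  rel_ten := by
    intro x y z
    obtain ⟨x, rfl⟩ := I.toSubmodule.mkQ_surjective x
    obtain ⟨y, rfl⟩ := I.toSubmodule.mkQ_surjective y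
    obtain ⟨z, rfl⟩ := I.toSubmodule.mkQ_surjective z
    simp only [quotientOp_mk, op, TriassociativeAlgebra.rel_ten]
  rel_eleven := by
    intro x y z
    obtain ⟨x, rfl⟩ := I.toSubmodule.mkQ_surjective x
    obtain ⟨y, rfl⟩ := I.toSubmodule.mkQ_surjective y
    obtain ⟨z, rfl⟩ := I.toSubmodule.mkQ_surjective z
    simp only [quotientOp_mk, op, TriassociativeAlgebra.rel_eleven]

end Quotient

section Cover

variable {k : Type v} [Field k]

/-- Homomorphisms of triassociative algebras: linear maps that preserve the three products. -/
def IsTriHom {K L : Type u} [AddCommGroup K] [Module k K] [TriassociativeAlgebra k K]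
    [AddCommGroup L] [Module k L] [TriassociativeAlgebra k L] (f : K →ₗ[k] L) : Prop :=
  ∀ (o : TriOp) (x y : K), f (op k o x y) = op k o (f x) (f y)

/-- `(K, ker p)` is a defining pair for `L`, where the isomorphism `K / ker p ≅ L` is the one
induced by the surjective homomorphism `p`: it is required that `ker p ⊆ Z(K) ∩ K'`. -/
structure IsDefiningPair {K L : Type u} [AddCommGroup K] [Module k K] [TriassociativeAlgebra k K]
    [AddCommGroup L] [Module k L] [TriassociativeAlgebra k L] (p : K →ₗ[k] L) : Prop where
  isTriHom : IsTriHom p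
  surjective : Function.Surjective p
  ker_le : LinearMap.ker p ≤ center k K ⊓ derived k K

/-- `(K, ker p)` is a maximal defining pair for `L`: the dimension of `K` is maximal among all
defining pairs of `L`. Then `K` is a cover of `L` and `ker p` is the multiplier `M(L)`. -/
structure IsCover {K L : Type u} [AddCommGroup K] [Module k K] [TriassociativeAlgebra k K]
    [AddCommGroup L] [Module k L] [TriassociativeAlgebra k L] (p : K →ₗ[k] L) : Prop
    extends IsDefiningPair p where
  maximal : ∀ (J : Type u) [AddCommGroup J] [Module k J] [TriassociativeAlgebra k J]
    (q : J →ₗ[k] L), IsDefiningPair q → Module.rank k J ≤ Module.rank k K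

/-- `L` has a cover, hence a multiplier. -/
def HasCover (k : Type v) [Field k] (L : Type u) [AddCommGroup L] [Module k L]
    [TriassociativeAlgebra k L] : Prop :=
  ∃ (K : Type u) (_ : AddCommGroup K) (_ : Module k K) (_ : TriassociativeAlgebra k K)
    (p : K →ₗ[k] L), IsCover p

end Cover

end Triassoc

open Triassoc

namespace Triassoc

open TensorProduct

/-! In a central extension `K` of `L`, a product depends only on the images of its factors in `L`.
So every such `K` receives a linear map `χ` from the space of formal products, that is, one copy of
`L ⊗ L` per operation modulo the eleven identities, and `χ` hits all of `K'`. For a defining pair,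
`ker p` is therefore the image under `χ` of the kernel of evaluation. This bounds `dim K`, and
twisting the product on `L × ker eval` attains the bound, so covers exist. In finite dimension,
maximality then forces `χ` to be injective for every cover.

Injectivity makes covers lift along central surjections: a linear lift can be corrected on the image
of `χ`, which contains all products. This gives `f` and `g`. Homomorphisms that agree modulo a
central subspace agree on derived ideals, so `β` and `γ` do not depend on the choices and `g ∘ f =
p` on `K'`. Exactness follows from this together with `T' ⊆ f(K')` and `L' ⊆ g(T')`. -/

instance : Finite TriOp :=
  Finite.of_injective (fun o : TriOp => (TriOp.rec 0 1 2 o : Fin 3)) (by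
    intro a b h
    cases a <;> cases b <;> simp_all)

/-- `TriRel a b c d` records that `(x a y) b z = x c (y d z)` is one of the eleven relations. -/
inductive TriRel : TriOp → TriOp → TriOp → TriOp → Prop
  | one : TriRel .vdash .vdash .vdash .vdash
  | two : TriRel .dashv .dashv .dashv .dashv
  | three : TriRel .dashv .vdash .vdash .vdash
  | four : TriRel .dashv .dashv .dashv .vdash
  | five : TriRel .vdash .dashv .vdash .dashv
  | six : TriRel .perp .vdash .vdash .vdash
  | seven : TriRel .dashv .dashv .dashv .perp
  | eight : TriRel .vdash .perp .vdash .perp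
  | nine : TriRel .perp .dashv .perp .dashv
  | ten : TriRel .dashv .perp .perp .vdash
  | eleven : TriRel .perp .perp .perp .perp

/-- A triassociative algebra from products satisfying all relations listed by `TriRel`. -/
abbrev TriassociativeAlgebra.ofRel {k : Type v} {L : Type u} [Field k] [AddCommGroup L]
    [Module k L] (mul : TriOp → L →ₗ[k] L →ₗ[k] L)
    (h : ∀ {a b c d}, TriRel a b c d → ∀ x y z, mul b (mul a x y) z = mul c x (mul d y z)) :
    TriassociativeAlgebra k L where
  mul := mul
  rel_one := h .one
  rel_two := h .two
  rel_three := h .three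
  rel_four := h .four
  rel_five := h .five
  rel_six := h .six
  rel_seven := h .seven
  rel_eight := h .eight
  rel_nine := h .nine
  rel_ten := h .ten
  rel_eleven := h .eleven

variable {k : Type v} [Field k]
variable {L : Type u} [AddCommGroup L] [Module k L] [TriassociativeAlgebra k L]
variable {K : Type u} [AddCommGroup K] [Module k K] [TriassociativeAlgebra k K]
variable {T : Type u} [AddCommGroup T] [Module k T] [TriassociativeAlgebra k T]
variable {Q : Type u} [AddCommGroup Q] [Module k Q] [TriassociativeAlgebra k Q]

theorem TriRel.op_eq {a b c d : TriOp} (h : TriRel a b c d) (x y z : L) :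
    op k b (op k a x y) z = op k c x (op k d y z) := by
  cases h
  exacts [TriassociativeAlgebra.rel_one x y z, TriassociativeAlgebra.rel_two x y z,
    TriassociativeAlgebra.rel_three x y z, TriassociativeAlgebra.rel_four x y z,
    TriassociativeAlgebra.rel_five x y z, TriassociativeAlgebra.rel_six x y z,
    TriassociativeAlgebra.rel_seven x y z, TriassociativeAlgebra.rel_eight x y z,
    TriassociativeAlgebra.rel_nine x y z, TriassociativeAlgebra.rel_ten x y z,
    TriassociativeAlgebra.rel_eleven x y z]

/-! ### Derived ideals and central kernels. -/

theorem op_mem_derived (o : TriOp) (x y : L) : op k o x y ∈ derived k L := by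
  have h := Submodule.apply_mem_map₂ (op k o) (Submodule.mem_top (x := x))
    (Submodule.mem_top (x := y))
  cases o
  exacts [Submodule.mem_sup_left (Submodule.mem_sup_left h),
    Submodule.mem_sup_left (Submodule.mem_sup_right h), Submodule.mem_sup_right h]

theorem derived_le {S : Submodule k L} (h : ∀ o x y, op k o x y ∈ S) : derived k L ≤ S :=
  sup_le (sup_le (Submodule.map₂_le.2 fun x _ y _ => h _ x y)
    (Submodule.map₂_le.2 fun x _ y _ => h _ x y)) (Submodule.map₂_le.2 fun x _ y _ => h _ x y)

omit [TriassociativeAlgebra k Q] in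
/-- Products only depend on the factors modulo a central subspace. -/
theorem op_congr {q : T →ₗ[k] Q} (hq : LinearMap.ker q ≤ center k T) (o : TriOp)
    {x x' y y' : T} (hx : q x = q x') (hy : q y = q y') : op k o x y = op k o x' y' := by
  have h₁ : x - x' ∈ center k T := hq (by simp [hx])
  have h₂ : y - y' ∈ center k T := hq (by simp [hy])
  have e₁ := (h₁ o y).1
  have e₂ := (h₂ o x').2
  rw [map_sub, LinearMap.sub_apply, sub_eq_zero] at e₁
  rw [map_sub, sub_eq_zero] at e₂
  exact e₁.trans e₂

omit [TriassociativeAlgebra k Q] in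
/-- Two homomorphisms that agree modulo a central subspace agree on the derived ideal. -/
theorem IsTriHom.eq_on_derived {q : T →ₗ[k] Q} (hq : LinearMap.ker q ≤ center k T)
    {f g : K →ₗ[k] T} (hf : IsTriHom f) (hg : IsTriHom g) (h : q ∘ₗ f = q ∘ₗ g) {x : K}
    (hx : x ∈ derived k K) : f x = g x :=
  derived_le (S := LinearMap.eqLocus f g) (fun o x y => by
    rw [LinearMap.mem_eqLocus, hf, hg]
    exact op_congr hq o (LinearMap.congr_fun h x) (LinearMap.congr_fun h y)) hx

theorem IsTriHom.derived_le_comap {f : K →ₗ[k] T} (hf : IsTriHom f) :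
    derived k K ≤ (derived k T).comap f :=
  derived_le fun o x y => by
    rw [Submodule.mem_comap, hf]
    exact op_mem_derived o _ _

omit [TriassociativeAlgebra k Q] in
/-- A homomorphism that is surjective modulo a central subspace is surjective on derived ideals. -/
theorem IsTriHom.derived_le_map {q : T →ₗ[k] Q} (hq : LinearMap.ker q ≤ center k T)
    {f : K →ₗ[k] T} (hf : IsTriHom f) (h : ∀ t, ∃ x, q (f x) = q t) :
    derived k T ≤ (derived k K).map f :=
  derived_le fun o s t => by
    obtain ⟨x, hx⟩ := h s
    obtain ⟨y, hy⟩ := h t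
    exact ⟨op k o x y, op_mem_derived o x y, by rw [hf, op_congr hq o hx hy]⟩

/-! ### Formal products and their evaluation. -/

variable (k L) in
/-- The relations among formal products imposed by `TriRel`. -/
noncomputable def productRelations : Submodule k (TriOp →₀ L ⊗[k] L) :=
  Submodule.span k {w | ∃ a b c d, TriRel a b c d ∧ ∃ x y z : L,
    w = Finsupp.single b (op k a x y ⊗ₜ z) - Finsupp.single c (x ⊗ₜ op k d y z)}

variable (k L) in
/-- The space of formal products `x * y` of elements of `L`, universal among the derived ideals
of central extensions of `L`. -/
noncomputable abbrev FormalProducts : Type u := (TriOp →₀ L ⊗[k] L) ⧸ productRelations k L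

/-- The formal product of two elements. -/
noncomputable def formalMul (o : TriOp) : L →ₗ[k] L →ₗ[k] FormalProducts k L :=
  (TensorProduct.mk k L L).compr₂ ((productRelations k L).mkQ ∘ₗ Finsupp.lsingle o)

theorem formalMul_rel {a b c d : TriOp} (h : TriRel a b c d) (x y z : L) :
    formalMul (k := k) b (op k a x y) z = formalMul c x (op k d y z) :=
  (Submodule.Quotient.eq _).2 (Submodule.subset_span ⟨a, b, c, d, h, x, y, z, rfl⟩)

/-- The linear map on formal products determined by compatible bilinear maps. -/
noncomputable def FormalProducts.lift (B : TriOp → L →ₗ[k] L →ₗ[k] T)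
    (h : ∀ {a b c d}, TriRel a b c d → ∀ x y z : L,
      B b (op k a x y) z = B c x (op k d y z)) : FormalProducts k L →ₗ[k] T :=
  (productRelations k L).liftQ (Finsupp.lsum k fun o => TensorProduct.lift (B o))
    (Submodule.span_le.2 (by
      rintro _ ⟨a, b, c, d, hr, x, y, z, rfl⟩
      simp only [SetLike.mem_coe, LinearMap.mem_ker, map_sub, Finsupp.lsum_single,
        TensorProduct.lift.tmul, h hr, sub_self]))

omit [TriassociativeAlgebra k T] in
@[simp]
theorem FormalProducts.lift_formalMul (B : TriOp → L →ₗ[k] L →ₗ[k] T)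
    (h : ∀ {a b c d}, TriRel a b c d → ∀ x y z : L,
      B b (op k a x y) z = B c x (op k d y z)) (o : TriOp) (x y : L) :
    FormalProducts.lift B h (formalMul o x y) = B o x y := by
  change Finsupp.lsum k (fun o => TensorProduct.lift (B o)) (Finsupp.single o (x ⊗ₜ y)) = _
  rw [Finsupp.lsum_single, TensorProduct.lift.tmul]

theorem FormalProducts.hom_ext {V : Type*} [AddCommGroup V] [Module k V]
    {f g : FormalProducts k L →ₗ[k] V}
    (h : ∀ o x y, f (formalMul o x y) = g (formalMul o x y)) : f = g := by
  apply Submodule.linearMap_qext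
  ext o x y
  exact h o x y

variable (k L) in
/-- The evaluation of formal products in `L`. -/
noncomputable def FormalProducts.eval : FormalProducts k L →ₗ[k] L :=
  FormalProducts.lift (op k) TriRel.op_eq

/-- For a homomorphism `h : L → Q` and a surjective homomorphism `q : T → Q` with central kernel,
formal products in `L` can be evaluated in `T`. -/
theorem FormalProducts.exists_eval {q : T →ₗ[k] Q} (hq : IsTriHom q)
    (hs : Function.Surjective q) (hc : LinearMap.ker q ≤ center k T) {h : L →ₗ[k] Q}
    (hh : IsTriHom h) :
    ∃ χ : FormalProducts k L →ₗ[k] T,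
      (∀ o x y s t, q s = h x → q t = h y → χ (formalMul o x y) = op k o s t) ∧
      q ∘ₗ χ = h ∘ₗ FormalProducts.eval k L := by
  obtain ⟨σ, hσ⟩ := q.exists_rightInverse_of_surjective (LinearMap.range_eq_top.2 hs)
  replace hσ : ∀ x, q (σ x) = x := LinearMap.congr_fun hσ
  -- The section `σ` is only linear, but its failure to be multiplicative lies in the central kernel
  -- of `q` and vanishes inside a product.
  have hr : ∀ {a b c d}, TriRel a b c d → ∀ x y z : L,
      (op k b).compl₁₂ (σ ∘ₗ h) (σ ∘ₗ h) (op k a x y) z =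
        (op k c).compl₁₂ (σ ∘ₗ h) (σ ∘ₗ h) x (op k d y z) := by
    intro a b c d r x y z
    calc op k b (σ (h (op k a x y))) (σ (h z))
        = op k b (op k a (σ (h x)) (σ (h y))) (σ (h z)) :=
          op_congr hc b (by rw [hσ, hh, hq, hσ, hσ]) rfl
      _ = op k c (σ (h x)) (op k d (σ (h y)) (σ (h z))) := r.op_eq _ _ _
      _ = op k c (σ (h x)) (σ (h (op k d y z))) :=
          op_congr hc c rfl (by rw [hσ, hh, hq, hσ, hσ])
  have key : ∀ o x y s t, q s = h x → q t = h y →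
      FormalProducts.lift _ hr (formalMul o x y) = op k o s t := by
    intro o x y s t hx hy
    rw [FormalProducts.lift_formalMul]
    exact op_congr hc o (by simp [hσ, hx]) (by simp [hσ, hy])
  refine ⟨FormalProducts.lift _ hr, key, FormalProducts.hom_ext fun o x y => ?_⟩
  rw [LinearMap.comp_apply, key o x y _ _ (hσ _) (hσ _), hq, hσ, hσ, LinearMap.comp_apply,
    FormalProducts.eval, FormalProducts.lift_formalMul, hh]

theorem IsTriHom.id : IsTriHom (LinearMap.id : L →ₗ[k] L) := fun _ _ _ => rfl

theorem IsTriHom.comp {f : K →ₗ[k] T} {g : T →ₗ[k] Q} (hg : IsTriHom g) (hf : IsTriHom f) :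
    IsTriHom (g ∘ₗ f) := fun o x y => by
  simp only [LinearMap.comp_apply, hf o x y, hg o (f x) (f y)]

/-! ### Defining pairs and existence of covers. -/

/-- The evaluation of formal products of `L` in a defining pair of `L`. It maps the formal
products with value zero onto the kernel of the defining pair. -/
theorem IsDefiningPair.exists_eval {p : K →ₗ[k] L} (hp : IsDefiningPair p) :
    ∃ χ : FormalProducts k L →ₗ[k] K,
      (∀ o x y, χ (formalMul o (p x) (p y)) = op k o x y) ∧
      p ∘ₗ χ = FormalProducts.eval k L ∧
      LinearMap.ker p = (LinearMap.ker (FormalProducts.eval k L)).map χ := by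
  obtain ⟨χ, h₁, h₂⟩ := FormalProducts.exists_eval hp.isTriHom hp.surjective
    (hp.ker_le.trans inf_le_left) (IsTriHom.id (L := L))
  rw [LinearMap.id_comp] at h₂
  refine ⟨χ, fun o x y => h₁ o _ _ _ _ rfl rfl, h₂, le_antisymm (fun m hm => ?_) ?_⟩
  · have : derived k K ≤ LinearMap.range χ :=
      derived_le fun o x y => ⟨_, h₁ o _ _ x y rfl rfl⟩
    obtain ⟨w, rfl⟩ := this (hp.ker_le hm).2
    exact ⟨w, by rw [SetLike.mem_coe, LinearMap.mem_ker, ← h₂]; exact hm, rfl⟩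
  · rintro _ ⟨w, hw, rfl⟩
    rw [SetLike.mem_coe, LinearMap.mem_ker, ← h₂] at hw
    exact hw

/-- Rank-nullity for `p`, whose kernel is a linear image of the kernel of evaluation. -/
theorem IsDefiningPair.rank_le {p : K →ₗ[k] L} (hp : IsDefiningPair p) :
    Module.rank k K ≤
      Module.rank k L + Module.rank k (LinearMap.ker (FormalProducts.eval k L)) := by
  obtain ⟨χ, -, -, h⟩ := hp.exists_eval
  rw [LinearMap.rank_eq_of_surjective hp.surjective, h]
  gcongr
  exact rank_map_le _ _

/-- The kernel of evaluation on formal products is the kernel of a defining pair, a central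
extension of `L` that realizes the upper bound `IsDefiningPair.rank_le`. -/
theorem exists_isDefiningPair_rank_eq (k : Type v) [Field k] (L : Type u) [AddCommGroup L]
    [Module k L] [TriassociativeAlgebra k L] :
    ∃ (K : Type u) (_ : AddCommGroup K) (_ : Module k K) (_ : TriassociativeAlgebra k K)
      (p : K →ₗ[k] L), IsDefiningPair p ∧ Module.rank k K =
        Module.rank k L + Module.rank k (LinearMap.ker (FormalProducts.eval k L)) := by
  obtain ⟨π, hπ⟩ := LinearMap.exists_leftInverse_of_injective
    (LinearMap.ker (FormalProducts.eval k L)).subtype (Submodule.ker_subtype _)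
  let A := LinearMap.ker (FormalProducts.eval k L)
  let m : TriOp → (L × A) →ₗ[k] (L × A) →ₗ[k] (L × A) := fun o =>
    ((op k o).compr₂ (LinearMap.inl k L A) +
      (formalMul o).compr₂ (LinearMap.inr k L A ∘ₗ π)).compl₁₂
      (LinearMap.fst k L A) (LinearMap.fst k L A)
  have hm : ∀ o x y, m o x y = (op k o x.1 y.1, π (formalMul o x.1 y.1)) := by
    intro o x y
    simp [m]
  -- Products ignore second coordinates, so each identity reduces to the one in `L` and the matching
  -- relation among formal products.
  let _ : TriassociativeAlgebra k (L × A) := .ofRel m fun r x y z => by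
    simp only [hm, r.op_eq, formalMul_rel r]
  have hop : ∀ o (x y : L × A), op k o x y = (op k o x.1 y.1, π (formalMul o x.1 y.1)) := hm
  have hs : Function.Surjective (LinearMap.fst k L A) := Prod.fst_surjective
  refine ⟨L × A, inferInstance, inferInstance, inferInstance, LinearMap.fst k L A,
    ⟨fun o x y => by simp [hop], hs, ?_⟩, rank_prod'⟩
  -- On `a` in the kernel of evaluation this map takes the value `(0, a)`, which places the kernel
  -- of the projection in the derived ideal.
  have hχ : ⊤ ≤ (derived k (L × A)).comap ((FormalProducts.eval k L).prod π) := by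
    have : (derived k (L × A)).mkQ ∘ₗ (FormalProducts.eval k L).prod π = 0 := by
      refine FormalProducts.hom_ext fun o x y => ?_
      have := op_mem_derived (k := k) o ((x, 0) : L × A) (y, 0)
      rw [hop] at this
      have e : (FormalProducts.eval k L).prod π (formalMul o x y) =
          (op k o x y, π (formalMul o x y)) :=
        Prod.ext (FormalProducts.lift_formalMul _ _ o x y) rfl
      rw [LinearMap.comp_apply, e]
      exact (Submodule.Quotient.mk_eq_zero _).2 this
    intro w _
    simpa using LinearMap.congr_fun this w
  rintro ⟨x, a⟩ (rfl : x = 0)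
  refine ⟨fun o y => ⟨?_, ?_⟩, ?_⟩
  · rw [hop]; simp
  · rw [hop]; simp
  · have := hχ (Submodule.mem_top (x := (a : FormalProducts k L)))
    have ha : FormalProducts.eval k L a = 0 := a.2
    have hb : π a = a := LinearMap.congr_fun hπ a
    simpa [ha, hb] using this

theorem hasCover (k : Type v) [Field k] (L : Type u) [AddCommGroup L]
    [Module k L] [TriassociativeAlgebra k L] : HasCover k L := by
  obtain ⟨K, _, _, _, p, hp, hr⟩ := exists_isDefiningPair_rank_eq k L
  exact ⟨K, _, _, _, p, hp, fun J _ _ _ q hq => hr ▸ hq.rank_le⟩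

/-- Formal products of a finite-dimensional algebra embed into every cover. -/
theorem IsCover.exists_eval [FiniteDimensional k L] {p : K →ₗ[k] L} (hp : IsCover p) :
    ∃ χ : FormalProducts k L →ₗ[k] K,
      (∀ o x y, χ (formalMul o (p x) (p y)) = op k o x y) ∧
      p ∘ₗ χ = FormalProducts.eval k L ∧ LinearMap.ker χ = ⊥ := by
  obtain ⟨χ, h₁, h₂, h₃⟩ := hp.toIsDefiningPair.exists_eval
  refine ⟨χ, h₁, h₂, ?_⟩
  obtain ⟨J, _, _, _, q, hq, hr⟩ := exists_isDefiningPair_rank_eq k L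
  have hle := hp.maximal J q hq
  rw [hr, LinearMap.rank_eq_of_surjective hp.surjective, h₃] at hle
  -- Finiteness of `TriOp` makes formal products finite-dimensional, so `dim L` can be cancelled.
  rw [← Module.finrank_eq_rank, ← Module.finrank_eq_rank, ← Module.finrank_eq_rank] at hle
  have hle' : Module.finrank k (LinearMap.ker (FormalProducts.eval k L)) ≤
      Module.finrank k ((LinearMap.ker (FormalProducts.eval k L)).map χ) := by
    norm_cast at hle
    omega
  have hinj : Function.Injective
      (χ.submoduleMap (LinearMap.ker (FormalProducts.eval k L))) :=
    (LinearMap.injective_iff_surjective_of_finrank_eq_finrank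
      (le_antisymm hle' (Submodule.finrank_map_le _ _))).2
      (LinearMap.submoduleMap_surjective _ _)
  -- Since `p ∘ χ` is evaluation, `ker χ` lies in the subspace where injectivity is already known.
  refine (Submodule.eq_bot_iff _).2 fun w hw => ?_
  have hw' : FormalProducts.eval k L w = 0 := by
    rw [← h₂, LinearMap.comp_apply, LinearMap.mem_ker.1 hw, map_zero]
  have := @hinj ⟨w, hw'⟩ 0 (Subtype.ext (by simpa using hw))
  exact congrArg Subtype.val this

/-- Covers lift along surjective homomorphisms with central kernel. -/
theorem IsCover.exists_lift [FiniteDimensional k L] {p : K →ₗ[k] L} (hp : IsCover p)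
    {q : T →ₗ[k] Q} (hq : IsTriHom q) (hs : Function.Surjective q)
    (hc : LinearMap.ker q ≤ center k T) {h : L →ₗ[k] Q} (hh : IsTriHom h) :
    ∃ f : K →ₗ[k] T, IsTriHom f ∧ q ∘ₗ f = h ∘ₗ p := by
  obtain ⟨χ, h₁, h₂, h₃⟩ := hp.exists_eval
  obtain ⟨ψ, h₄, h₅⟩ := FormalProducts.exists_eval hq hs hc hh
  obtain ⟨σ, hσ⟩ := q.exists_rightInverse_of_surjective (LinearMap.range_eq_top.2 hs)
  obtain ⟨r, hr⟩ := χ.exists_leftInverse_of_injective h₃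
  let f₀ : K →ₗ[k] T := σ ∘ₗ h ∘ₗ p
  -- The correction takes values in `ker q` and makes `f ∘ χ = ψ`. As products in `K` are values of
  -- `χ`, this is multiplicativity.
  let f : K →ₗ[k] T := f₀ + (ψ - f₀ ∘ₗ χ) ∘ₗ r
  have hf₀ : q ∘ₗ f₀ = h ∘ₗ p := by
    rw [← LinearMap.comp_assoc, hσ, LinearMap.id_comp]
  have hδ : q ∘ₗ (ψ - f₀ ∘ₗ χ) = 0 := by
    rw [LinearMap.comp_sub, h₅, ← LinearMap.comp_assoc, hf₀, LinearMap.comp_assoc, h₂, sub_self]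
  have hqf : q ∘ₗ f = h ∘ₗ p := by
    rw [LinearMap.comp_add, ← LinearMap.comp_assoc r, hδ, LinearMap.zero_comp, add_zero, hf₀]
  have hfχ : ∀ w, f (χ w) = ψ w := by
    intro w
    have : r (χ w) = w := LinearMap.congr_fun hr w
    simp [f, this]
  exact ⟨f, fun o x y => by
    rw [← h₁, hfχ, h₄ o _ _ _ _ (LinearMap.congr_fun hqf x) (LinearMap.congr_fun hqf y)], hqf⟩

end Triassoc

open Triassoc

/-! ### The exact sequence. -/

theorem mainTheorem9 {k : Type v} [Field k] {L : Type u} [AddCommGroup L] [Module k L]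
    [TriassociativeAlgebra k L] [FiniteDimensional k L]
    (Z : TriIdeal k L) (hZ : Z.toSubmodule ≤ center k L) :
    HasCover k L ∧ HasCover k (L ⧸ Z.toSubmodule) ∧
    ∀ (K : Type u) [AddCommGroup K] [Module k K] [TriassociativeAlgebra k K]
      (p : K →ₗ[k] L) (_ : IsCover p)
      (T : Type u) [AddCommGroup T] [Module k T] [TriassociativeAlgebra k T]
      (q : T →ₗ[k] (L ⧸ Z.toSubmodule)) (_ : IsCover q),
      -- the maps `M(L) → M(L/Z)` and `M(L/Z) → Z`
      ∃ (β : LinearMap.ker p →ₗ[k] LinearMap.ker q)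
        (γ : LinearMap.ker q →ₗ[k] Z.toSubmodule),
        -- `β` is the restriction of any homomorphism `K → T` that covers `L → L/Z`
        (∃ f : K →ₗ[k] T, IsTriHom f ∧ q ∘ₗ f = Z.toSubmodule.mkQ ∘ₗ p) ∧
        (∀ f : K →ₗ[k] T, IsTriHom f → q ∘ₗ f = Z.toSubmodule.mkQ ∘ₗ p →
          ∀ m : LinearMap.ker p, (β m : T) = f (m : K)) ∧
        -- `γ` is the restriction of any homomorphism `T → L` over `L/Z`
        (∃ g : T →ₗ[k] L, IsTriHom g ∧ Z.toSubmodule.mkQ ∘ₗ g = q) ∧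
        (∀ g : T →ₗ[k] L, IsTriHom g → Z.toSubmodule.mkQ ∘ₗ g = q →
          ∀ m : LinearMap.ker q, (γ m : L) = g (m : T)) ∧
        -- exactness of `M(L) → M(L/Z) → Z → L/L' → L/(Z + L') → 0`
        Function.Exact β γ ∧
        Function.Exact γ ((derived k L).mkQ ∘ₗ Z.toSubmodule.subtype) ∧
        Function.Exact ((derived k L).mkQ ∘ₗ Z.toSubmodule.subtype)
          (Submodule.factor (le_sup_right : derived k L ≤ Z.toSubmodule ⊔ derived k L)) ∧
        Function.Surjective
          (Submodule.factor (le_sup_right : derived k L ≤ Z.toSubmodule ⊔ derived k L)) := by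
  have hquot : IsTriHom Z.toSubmodule.mkQ := fun _ _ _ => rfl
  have hker : LinearMap.ker Z.toSubmodule.mkQ ≤ center k L := by rwa [Submodule.ker_mkQ]
  refine ⟨hasCover k L, hasCover k _, ?_⟩
  intro K _ _ _ p hp T _ _ _ q hq
  have hqc : LinearMap.ker q ≤ center k T := hq.ker_le.trans inf_le_left
  obtain ⟨f, hf, hqf⟩ := hp.exists_lift hq.isTriHom hq.surjective hqc hquot
  obtain ⟨g, hg, hgq⟩ := hq.exists_lift hquot Z.toSubmodule.mkQ_surjective hker
    (IsTriHom.id (L := L ⧸ Z.toSubmodule))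
  rw [LinearMap.id_comp] at hgq
  have hqf' : ∀ x, q (f x) = Z.toSubmodule.mkQ (p x) := LinearMap.congr_fun hqf
  have hgq' : ∀ t, Z.toSubmodule.mkQ (g t) = q t := LinearMap.congr_fun hgq
  -- Both sides are homomorphisms to `L` that agree modulo the central ideal `Z`.
  have hgf : ∀ x ∈ derived k K, g (f x) = p x := fun x hx =>
    (hg.comp hf).eq_on_derived hker hp.isTriHom (by rw [← LinearMap.comp_assoc, hgq, hqf]) hx
  refine ⟨f.restrict fun m hm => ?_, LinearMap.restrict g fun m hm => ?_,
    ⟨f, hf, hqf⟩, fun f' hf' hqf' m => ?_, ⟨g, hg, hgq⟩, fun g' hg' hgq' m => ?_,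
    ?_, ?_, ?_, Submodule.factor_surjective _⟩
  · rw [LinearMap.mem_ker] at hm ⊢
    rw [hqf', hm, map_zero]
  · rw [LinearMap.mem_ker] at hm
    rw [← Submodule.ker_mkQ Z.toSubmodule, LinearMap.mem_ker, hgq', hm]
  · exact hf.eq_on_derived hqc hf' (hqf.trans hqf'.symm) (hp.ker_le m.2).2
  · exact hg.eq_on_derived hker hg' (hgq.trans hgq'.symm) (hq.ker_le m.2).2
  · rintro ⟨t, ht⟩
    constructor
    · intro h
      replace h : g t = 0 := congrArg Subtype.val h
      -- Lifting `t` to `x` in `K'` gives `p x = g (f x) = 0`, so `x` lies in `M(L)`.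
      have hsurj : ∀ t, ∃ x, q (f x) = q t := fun t => by
        obtain ⟨l, hl⟩ := Z.toSubmodule.mkQ_surjective (q t)
        obtain ⟨x, rfl⟩ := hp.surjective l
        exact ⟨x, (hqf' x).trans hl⟩
      obtain ⟨x, hx, rfl⟩ := hf.derived_le_map hqc hsurj (hq.ker_le ht).2
      exact ⟨⟨x, by rw [LinearMap.mem_ker, ← hgf x hx, h]⟩, rfl⟩
    · rintro ⟨m, hm⟩
      obtain rfl : f m = t := congrArg Subtype.val hm
      exact Subtype.ext ((hgf m (hp.ker_le m.2).2).trans m.2)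
  · rintro ⟨z, hz⟩
    constructor
    · intro h
      replace h : z ∈ derived k L := by simpa using h
      have hsurj : ∀ l, ∃ t, Z.toSubmodule.mkQ (g t) = Z.toSubmodule.mkQ l := fun l => by
        obtain ⟨t, ht⟩ := hq.surjective (Z.toSubmodule.mkQ l)
        exact ⟨t, (hgq' t).trans ht⟩
      obtain ⟨t, -, rfl⟩ := hg.derived_le_map hker hsurj h
      exact ⟨⟨t, by rw [LinearMap.mem_ker, ← hgq']; simpa using hz⟩, rfl⟩
    · rintro ⟨t, ht⟩
      obtain rfl : g t = z := congrArg Subtype.val ht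
      simpa using hg.derived_le_comap (hq.ker_le t.2).2
  · intro l
    obtain ⟨l, rfl⟩ := (derived k L).mkQ_surjective l
    constructor
    · intro h
      replace h : l ∈ Z.toSubmodule ⊔ derived k L := by simpa using h
      obtain ⟨z, hz, d, hd, rfl⟩ := Submodule.mem_sup.1 h
      exact ⟨⟨z, hz⟩, by simpa using hd⟩
    · rintro ⟨z, hz⟩
      rw [← hz]
      simpa using Submodule.mem_sup_left z.2
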